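/- Let $\mathcal A$ be a unital $C^*$-algebra and let $$H_{\mathcal A}=\Big\{x=(x_i)_{i\in\mathbb N}\subseteq\mathcal A:\ \sum_i x_i x_i^*\ \text{converges in norm}\Big\}$$ be the standard Hilbert $\mathcal A$-module, written as a left module, with inner product $\langle x,y\rangle=\sum_i y_i x_i^*$ and norm $\|x\|=\|\langle x,x\rangle\|^{1/2}$. Let $B^a(H_{\mathcal A})$ be the algebra of all bounded adjointable operators on $H_{\mathcal A}$, and let $K(H_{\mathcal A})$ be the ideal of compact operators, i.e. the operator-norm closure of the linear span of the operators $\theta_{x,y}(z)=\langle y,z\rangle x$, $x,y\in H_{\mathcal A}$. An operator $F\in B^a(H_{\mathcal A})$ is called upper semi-$\mathcal A$-Fredholm if there are closed submodules $M_1,N_1,M_2,N_2$ of $H_{\mathcal A}$, with $N_1$ finitely generated over $\mathcal A$, such that $H_{\mathcal A}=M_1\,\tilde\oplus\,N_1=M_2\,\tilde\oplus\,N_2$ (direct sums, not necessarily orthogonal), $F(M_1)\subseteq M_2$, $F(N_1)\subseteq N_2$, and $F|_{M_1}:M_1\to M_2$ is an isomorphism (a bounded $\mathcal A$-linear bijection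 with bounded inverse). **Theorem.** For every $F\in B^a(H_{\mathcal A})$ the following statements are equivalent: 1. $F$ is upper semi-$\mathcal A$-Fredholm; 2. there exist $D\in B^a(H_{\mathcal A})$ and $K\in K(H_{\mathcal A})$ such that $DF=I+K$; 3. the class of $F$ is left invertible in the Calkin algebra $B^a(H_{\mathcal A})/K(H_{\mathcal A})$. -/

import Mathlib

open scoped InnerProductSpace

/-! ### The standard Hilbert module `H_A`

Hilbert C⋆-modules are taken with Mathlib's convention (`CStarModule`): the algebra acts on the
left and the `A`-valued inner product `⟪x, y⟫_A` is `A`-linear in its second argument, so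
`⟪a, b⟫_A = b * star a` on `A` itself.  -/

section Summability

variable {A : Type*} [CStarAlgebra A]

theorem summable_of_nonneg_of_le_cstar [PartialOrder A] [StarOrderedRing A] {f g : ℕ → A}
    (hf : ∀ i, 0 ≤ f i) (hfg : ∀ i, f i ≤ g i) (hg : Summable g) : Summable f := by
  rw [summable_iff_vanishing_norm] at hg ⊢
  intro ε hε
  obtain ⟨s, hs⟩ := hg ε hε
  refine ⟨s, fun t ht => lt_of_le_of_lt ?_ (hs t ht)⟩
  exact CStarAlgebra.norm_le_norm_of_nonneg_of_le (Finset.sum_nonneg fun i _ => hf i)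
    (Finset.sum_le_sum fun i _ => hfg i)

theorem summable_add_mul_star {x y : ℕ → A} (hx : Summable fun i => x i * star (x i))
    (hy : Summable fun i => y i * star (y i)) :
    Summable fun i => (x i + y i) * star (x i + y i) := by
  let := CStarAlgebra.spectralOrder A
  have := CStarAlgebra.spectralOrderedRing A
  refine summable_of_nonneg_of_le_cstar (fun i => mul_star_self_nonneg _) (fun i => ?_)
    ((hx.add hy).add (hx.add hy))
  have h := mul_star_self_nonneg (x i - y i)
  rw [← sub_nonneg]
  convert h using 1
  simp only [star_add, star_sub]
  noncomm_ring

end Summability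

/-- The sequences `x` in `A` for which `∑ x i * star (x i)` converges in norm. (The terms are
positive, so convergence of the series and unconditional convergence are the same thing.) -/
def standardSubmodule (A : Type*) [CStarAlgebra A] : Submodule A (ℕ → A) where
  carrier := {x | Summable fun i => x i * star (x i)}
  add_mem' hx hy := summable_add_mul_star hx hy
  zero_mem' := by simp
  smul_mem' a x hx := by
    have h : Summable fun i => a * (x i * star (x i)) * star a :=
      (Summable.mul_left a hx).mul_right (star a)
    simpa [mul_assoc] using h

/-- The standard Hilbert module `H_A = ℓ²(A)` over a unital C⋆-algebra `A`. -/
def StandardModule (A : Type*) [CStarAlgebra A] : Type _ := standardSubmodule A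

namespace StandardModule

variable {A : Type*} [CStarAlgebra A]

instance : AddCommGroup (StandardModule A) := inferInstanceAs (AddCommGroup (standardSubmodule A))

instance : Module A (StandardModule A) := inferInstanceAs (Module A (standardSubmodule A))

noncomputable instance : Module ℂ (StandardModule A) :=
  inferInstanceAs (Module ℂ (standardSubmodule A))

instance : IsScalarTower ℂ A (StandardModule A) :=
  inferInstanceAs (IsScalarTower ℂ A (standardSubmodule A))

/-- The `i`-th entry of an element of `H_A`. -/
def coord (x : StandardModule A) (i : ℕ) : A := x.1 i

@[ext] theorem ext {x y : StandardModule A} (h : ∀ i, x.coord i = y.coord i) : x = y :=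
  Subtype.ext (funext h)

@[simp] theorem coord_add (x y : StandardModule A) (i : ℕ) :
    (x + y).coord i = x.coord i + y.coord i := rfl

@[simp] theorem coord_zero (i : ℕ) : (0 : StandardModule A).coord i = 0 := rfl

@[simp] theorem coord_smul (a : A) (x : StandardModule A) (i : ℕ) :
    (a • x).coord i = a * x.coord i := rfl

@[simp] theorem coord_smul_complex (c : ℂ) (x : StandardModule A) (i : ℕ) :
    (c • x).coord i = c • x.coord i := rfl

theorem summable_self (x : StandardModule A) : Summable fun i => x.coord i * star (x.coord i) :=
  x.2

theorem summable_inner (x y : StandardModule A) :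
    Summable fun i => y.coord i * star (x.coord i) := by
  have h := (((summable_self (y + x)).sub (summable_self (y + (-1 : ℂ) • x))).add
    (((summable_self (y + Complex.I • x)).sub
      (summable_self (y + (-Complex.I) • x))).const_smul Complex.I)).const_smul (1 / 4 : ℂ)
  refine h.congr fun i => ?_
  simp only [coord_add, coord_smul_complex, star_add, star_smul, mul_add, add_mul, smul_mul_assoc,
    mul_smul_comm, smul_add, smul_sub, smul_smul, star_neg, star_one, RCLike.star_def,
    Complex.conj_I]
  match_scalars
  all_goals ring_nf
  all_goals simp [Complex.I_sq]
  all_goals norm_num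

/-- The `A`-valued inner product of `H_A`. -/
noncomputable instance : Inner A (StandardModule A) where
  inner x y := ∑' i, y.coord i * star (x.coord i)

theorem inner_def (x y : StandardModule A) :
    ⟪x, y⟫_A = ∑' i, y.coord i * star (x.coord i) := rfl

/-- The norm `‖x‖ = ‖⟪x, x⟫‖ ^ (1 / 2)` of `H_A`. -/
noncomputable instance : Norm (StandardModule A) where
  norm x := √‖⟪x, x⟫_A‖

noncomputable instance [PartialOrder A] [StarOrderedRing A] : CStarModule A (StandardModule A) where
  inner_add_right {x y z} := by
    simp only [inner_def, coord_add, add_mul]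
    exact (summable_inner x y).tsum_add (summable_inner x z)
  inner_self_nonneg := tsum_nonneg fun i => mul_star_self_nonneg _
  inner_self {x} := by
    constructor
    · intro h
      have h0 := (hasSum_zero_iff_of_nonneg (fun i => mul_star_self_nonneg (x.coord i))).1
        (by simpa [← inner_def, h] using (summable_self x).hasSum)
      exact ext fun i => (CStarRing.mul_star_self_eq_zero_iff _).1 (congrFun h0 i)
    · rintro rfl
      simp [inner_def]
  inner_op_smul_right {a x y} := by
    simp only [inner_def, coord_smul, mul_assoc]
    exact (summable_inner x y).tsum_mul_left a
  inner_smul_right_complex {c x y} := by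
    simp only [inner_def, coord_smul_complex, smul_mul_assoc]
    exact (summable_inner x y).tsum_const_smul c
  star_inner x y := by
    simp only [inner_def]
    rw [tsum_star]
    simp
  norm_eq_sqrt_norm_inner_self _ := rfl

theorem normedSpaceCore : NormedSpace.Core ℂ (StandardModule A) := by
  let := CStarAlgebra.spectralOrder A
  have := CStarAlgebra.spectralOrderedRing A
  exact CStarModule.normedSpaceCore A

noncomputable instance : NormedAddCommGroup (StandardModule A) :=
  NormedAddCommGroup.ofCore normedSpaceCore

noncomputable instance : NormedSpace ℂ (StandardModule A) :=
  NormedSpace.ofCore normedSpaceCore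

section Inner

variable (a : A) (c : ℂ) (x y z : StandardModule A)

@[simp] theorem inner_add_right' : ⟪x, y + z⟫_A = ⟪x, y⟫_A + ⟪x, z⟫_A := by
  let := CStarAlgebra.spectralOrder A
  have := CStarAlgebra.spectralOrderedRing A
  exact CStarModule.inner_add_right (A := A) (E := StandardModule A)

@[simp] theorem inner_add_left' : ⟪x + y, z⟫_A = ⟪x, z⟫_A + ⟪y, z⟫_A := by
  let := CStarAlgebra.spectralOrder A
  have := CStarAlgebra.spectralOrderedRing A
  exact CStarModule.inner_add_left (A := A) (E := StandardModule A)

@[simp] theorem inner_sub_left' : ⟪x - y, z⟫_A = ⟪x, z⟫_A - ⟪y, z⟫_A := by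
  let := CStarAlgebra.spectralOrder A
  have := CStarAlgebra.spectralOrderedRing A
  exact CStarModule.inner_sub_left (A := A) (E := StandardModule A)

@[simp] theorem inner_smul_right' : ⟪x, a • y⟫_A = a * ⟪x, y⟫_A := by
  let := CStarAlgebra.spectralOrder A
  have := CStarAlgebra.spectralOrderedRing A
  exact CStarModule.inner_op_smul_right (A := A) (E := StandardModule A)

@[simp] theorem inner_smul_left' : ⟪a • x, y⟫_A = ⟪x, y⟫_A * star a := by
  let := CStarAlgebra.spectralOrder A
  have := CStarAlgebra.spectralOrderedRing A
  exact CStarModule.inner_op_smul_left (A := A) (E := StandardModule A)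

@[simp] theorem inner_smul_right_complex' : ⟪x, c • y⟫_A = c • ⟪x, y⟫_A := by
  let := CStarAlgebra.spectralOrder A
  have := CStarAlgebra.spectralOrderedRing A
  exact CStarModule.inner_smul_right_complex (A := A) (E := StandardModule A)

@[simp] theorem inner_smul_left_complex' : ⟪c • x, y⟫_A = star c • ⟪x, y⟫_A := by
  let := CStarAlgebra.spectralOrder A
  have := CStarAlgebra.spectralOrderedRing A
  exact CStarModule.inner_smul_left_complex (A := A) (E := StandardModule A)

@[simp] theorem star_inner' : star ⟪x, y⟫_A = ⟪y, x⟫_A := by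
  let := CStarAlgebra.spectralOrder A
  have := CStarAlgebra.spectralOrderedRing A
  exact CStarModule.star_inner (A := A) (E := StandardModule A) x y

@[simp] theorem inner_self_eq_zero' : ⟪x, x⟫_A = 0 ↔ x = 0 := by
  let := CStarAlgebra.spectralOrder A
  have := CStarAlgebra.spectralOrderedRing A
  exact CStarModule.inner_self (A := A) (E := StandardModule A)

end Inner

theorem norm_sq_eq' (x : StandardModule A) : ‖x‖ ^ 2 = ‖⟪x, x⟫_A‖ :=
  Real.sq_sqrt (norm_nonneg _)

theorem norm_smul_le' (a : A) (x : StandardModule A) : ‖a • x‖ ≤ ‖a‖ * ‖x‖ := by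
  refine (sq_le_sq₀ (norm_nonneg _) (by positivity)).1 ?_
  rw [mul_pow, norm_sq_eq', norm_sq_eq' x]
  simp only [inner_smul_right', inner_smul_left']
  calc ‖a * (⟪x, x⟫_A * star a)‖ ≤ ‖a‖ * (‖⟪x, x⟫_A‖ * ‖star a‖) :=
        (norm_mul_le _ _).trans (by gcongr; exact norm_mul_le _ _)
    _ = ‖a‖ ^ 2 * ‖⟪x, x⟫_A‖ := by rw [norm_star]; ring

theorem norm_inner_le' (x y : StandardModule A) : ‖⟪x, y⟫_A‖ ≤ ‖x‖ * ‖y‖ := by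
  let := CStarAlgebra.spectralOrder A
  have := CStarAlgebra.spectralOrderedRing A
  exact CStarModule.norm_inner_le (StandardModule A)

end StandardModule

/-! ### Adjointable and compact operators -/

section Operators

variable {A : Type*} [CStarAlgebra A]

/-- `T` is adjointable: there is `S` with `⟪T x, y⟫ = ⟪x, S y⟫` for all `x`, `y`. (Such a `T` is
automatically `A`-linear.) -/
def IsAdjointable (T : StandardModule A →L[ℂ] StandardModule A) : Prop :=
  ∃ S : StandardModule A →L[ℂ] StandardModule A, ∀ x y, ⟪T x, y⟫_A = ⟪x, S y⟫_A

variable (A) in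
/-- The algebra `B^a(H_A)` of all bounded adjointable operators on `H_A`, with the operator
norm. -/
noncomputable def AdjointableOperators :
    Subalgebra ℂ (StandardModule A →L[ℂ] StandardModule A) where
  carrier := {T | IsAdjointable T}
  mul_mem' := by
    rintro T₁ T₂ ⟨S₁, h₁⟩ ⟨S₂, h₂⟩
    exact ⟨S₂ * S₁, fun x y => by simp [h₁, h₂]⟩
  add_mem' := by
    rintro T₁ T₂ ⟨S₁, h₁⟩ ⟨S₂, h₂⟩
    exact ⟨S₁ + S₂, fun x y => by simp [h₁, h₂]⟩
  algebraMap_mem' c := by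
    exact ⟨algebraMap ℂ _ (star c), fun x y => by simp [Algebra.algebraMap_eq_smul_one]⟩

/-- The elementary operator `θ_{x,y} : z ↦ ⟪y, z⟫ • x`, as a bounded operator. -/
noncomputable def elementaryCLM (x y : StandardModule A) :
    StandardModule A →L[ℂ] StandardModule A :=
  LinearMap.mkContinuous
    { toFun := fun z => ⟪y, z⟫_A • x
      map_add' := fun z w => by
        simp [add_smul]
      map_smul' := fun c z => by
        simp }
    (‖y‖ * ‖x‖) fun z => by
      calc ‖⟪y, z⟫_A • x‖ ≤ ‖⟪y, z⟫_A‖ * ‖x‖ := StandardModule.norm_smul_le' _ _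
        _ ≤ (‖y‖ * ‖z‖) * ‖x‖ := by gcongr; exact StandardModule.norm_inner_le' _ _
        _ = ‖y‖ * ‖x‖ * ‖z‖ := by ring

@[simp] theorem elementaryCLM_apply (x y z : StandardModule A) :
    elementaryCLM x y z = ⟪y, z⟫_A • x := rfl

theorem IsAdjointable.map_smul {T : StandardModule A →L[ℂ] StandardModule A}
    (hT : IsAdjointable T) (a : A) (x : StandardModule A) : T (a • x) = a • T x := by
  obtain ⟨S, hS⟩ := hT
  have h : ∀ w, ⟪T (a • x) - a • T x, w⟫_A = 0 := fun w => by simp [hS]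
  exact sub_eq_zero.1 ((StandardModule.inner_self_eq_zero' _).1 (h _))

/-- The elementary operator `θ_{x,y} : z ↦ ⟪y, z⟫ • x`, as an element of `B^a(H_A)`; its adjoint
is `θ_{y,x}`. -/
noncomputable def elementaryOperator (x y : StandardModule A) : AdjointableOperators A :=
  ⟨elementaryCLM x y, elementaryCLM y x, fun z w => by
    simp⟩

variable (A) in
/-- `K(H_A)`: the closure, in the operator norm, of the linear span of the elementary operators. -/
noncomputable def compactSubmodule : Submodule ℂ (AdjointableOperators A) :=
  (Submodule.span ℂ
    {T | ∃ x y : StandardModule A, T = elementaryOperator x y}).topologicalClosure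

theorem mul_elementaryOperator (T : AdjointableOperators A) (x y : StandardModule A) :
    T * elementaryOperator x y = elementaryOperator (T.1 x) y :=
  Subtype.ext <| ContinuousLinearMap.ext fun _ => T.2.map_smul _ _

theorem elementaryOperator_mul (T : AdjointableOperators A) (x y : StandardModule A) :
    ∃ y', elementaryOperator x y * T = elementaryOperator x y' := by
  obtain ⟨S, hS⟩ := T.2
  refine ⟨S y, Subtype.ext <| ContinuousLinearMap.ext fun z => ?_⟩
  have h : ⟪y, T.1 z⟫_A = ⟪S y, z⟫_A := by
    rw [← StandardModule.star_inner', hS, StandardModule.star_inner']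
  exact congrArg (· • x) h

theorem compactSubmodule_mul_left (T : AdjointableOperators A) {K : AdjointableOperators A}
    (hK : K ∈ compactSubmodule A) : T * K ∈ compactSubmodule A := by
  have hc : Continuous fun L : AdjointableOperators A => T * L := continuous_const.mul continuous_id
  refine map_mem_closure (f := fun L => T * L) hc hK fun L hL => ?_
  refine Submodule.span_induction (p := fun L _ => T * L ∈ Submodule.span ℂ _) ?_ ?_ ?_ ?_ hL
  · rintro _ ⟨x, y, rfl⟩
    exact Submodule.subset_span ⟨_, _, mul_elementaryOperator T x y⟩
  · simp
  · intro L₁ L₂ _ _ h₁ h₂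
    simpa [mul_add] using add_mem h₁ h₂
  · intro c L₁ _ h₁
    simpa using Submodule.smul_mem _ c h₁

theorem compactSubmodule_mul_right (T : AdjointableOperators A) {K : AdjointableOperators A}
    (hK : K ∈ compactSubmodule A) : K * T ∈ compactSubmodule A := by
  have hc : Continuous fun L : AdjointableOperators A => L * T := continuous_id.mul continuous_const
  refine map_mem_closure (f := fun L => L * T) hc hK fun L hL => ?_
  refine Submodule.span_induction (p := fun L _ => L * T ∈ Submodule.span ℂ _) ?_ ?_ ?_ ?_ hL
  · rintro _ ⟨x, y, rfl⟩
    obtain ⟨y', h⟩ := elementaryOperator_mul T x y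
    exact Submodule.subset_span ⟨_, _, h⟩
  · simp
  · intro L₁ L₂ _ _ h₁ h₂
    simpa [add_mul] using add_mem h₁ h₂
  · intro c L₁ _ h₁
    simpa using Submodule.smul_mem _ c h₁

variable (A) in
/-- The compact operators `K(H_A)` as an ideal of `B^a(H_A)`. -/
noncomputable def CompactOperators : Ideal (AdjointableOperators A) where
  carrier := compactSubmodule A
  add_mem' := add_mem
  zero_mem' := zero_mem _
  smul_mem' T _ hK := compactSubmodule_mul_left T hK

instance : (CompactOperators A).IsTwoSided :=
  ⟨fun T hK => compactSubmodule_mul_right T hK⟩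

variable (A) in
/-- The Calkin algebra `B^a(H_A) / K(H_A)`. -/
abbrev CalkinAlgebra := AdjointableOperators A ⧸ CompactOperators A

/-- `F` is upper semi-`A`-Fredholm: there are closed submodules with
`H_A = M₁ ⊕ N₁ = M₂ ⊕ N₂` (direct, not necessarily orthogonal, sums), `N₁` finitely generated,
such that `F` is diagonal with respect to these decompositions and its corner `M₁ → M₂` is an
isomorphism. -/
def IsUpperSemiFredholm (F : AdjointableOperators A) : Prop :=
  ∃ M₁ N₁ M₂ N₂ : Submodule A (StandardModule A),
    IsClosed (M₁ : Set (StandardModule A)) ∧ IsClosed (N₁ : Set (StandardModule A)) ∧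
    IsClosed (M₂ : Set (StandardModule A)) ∧ IsClosed (N₂ : Set (StandardModule A)) ∧
    IsCompl M₁ N₁ ∧ IsCompl M₂ N₂ ∧ N₁.FG ∧
    (∃ F₁ : M₁ ≃L[A] M₂, ∀ x : M₁, (F₁ x : StandardModule A) = F.1 x) ∧
    (∀ x ∈ N₁, F.1 x ∈ N₂)

end Operators

/-! Let `F` be left invertible modulo compacts, `D F = 1 + K`. The projections `Q` onto the tails of
sequences satisfy `‖K Q‖ → 0`, so for a far enough tail `1 + Q K Q` is invertible, and `D' = Q (1 +
Q K Q)⁻¹ Q D` satisfies `D' F Q = Q` and `Q D' = D'`. Hence `D' F D' = D'`, both `D' F` and `F D'`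
are idempotents, and their ranges and kernels give the two decompositions. The kernel of `D' F` is
generated by the vectors `e i - D' F (e i)` with `i < n`.

Conversely, a closed finitely generated `N₁` is the range of a compact orthogonal projection `P`,
obtained by inverting the frame operator of a generating family on `N₁`. With `Q = 1 - P`, the
operator `F` is bounded below on the range of `Q`, so `S = Q F* F Q + P` is invertible. Then `D =
S⁻¹ Q F*` satisfies `D F Q = Q`, that is, `D F = 1 + (D F - 1) P`.

Both inversions concern a positive `S`. Order estimates in `A` for `⟪S x + t x, x⟫` bound `S + t`
below uniformly in `t ≥ 0`, and the method of continuity then makes `S` invertible. -/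

/-! ### Method of continuity. -/

section ContinuityMethod

open ContinuousLinearMap in
/-- Method of continuity: if `S + t` is bounded below uniformly in `t ≥ 0`, then `S` is
invertible. -/
theorem isUnit_of_forall_add_smul_bounded_below {E : Type*} [NormedAddCommGroup E]
    [NormedSpace ℂ E] [CompleteSpace E] (S : E →L[ℂ] E) {c : ℝ} (hc : 0 < c)
    (h : ∀ t : ℝ, 0 ≤ t → ∀ x, c * ‖x‖ ≤ ‖S x + (t : ℂ) • x‖) : IsUnit S := by
  -- The inverse at `t` has norm at most `c⁻¹`, so the Neumann series for `S + s = (S + t)(1 - (t -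
  -- s)(S + t)⁻¹)` converges for `|t - s| < c`, a radius independent of `t`.
  have step : ∀ t s : ℝ, 0 ≤ t → |t - s| < c → IsUnit (S + (t : ℂ) • (1 : E →L[ℂ] E)) →
      IsUnit (S + (s : ℂ) • (1 : E →L[ℂ] E)) := by
    rintro t s ht hts ⟨u, hu⟩
    have hinv : ‖(↑u⁻¹ : E →L[ℂ] E)‖ ≤ c⁻¹ := by
      refine opNorm_le_bound _ (by positivity) fun y => ?_
      have h1 := h t ht ((↑u⁻¹ : E →L[ℂ] E) y)
      have h2 : (S + (t : ℂ) • (1 : E →L[ℂ] E)) ((↑u⁻¹ : E →L[ℂ] E) y) = y := by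
        rw [← hu]
        exact congrArg (fun T : E →L[ℂ] E => T y) u.mul_inv
      have h3 : S ((↑u⁻¹ : E →L[ℂ] E) y) + (t : ℂ) • (↑u⁻¹ : E →L[ℂ] E) y = y := by
        simpa using h2
      rw [h3] at h1
      rw [inv_mul_eq_div, le_div_iff₀ hc, mul_comm]
      exact h1
    have hx : ‖((t - s : ℝ) : ℂ) • (↑u⁻¹ : E →L[ℂ] E)‖ < 1 := by
      rw [norm_smul, Complex.norm_real, Real.norm_eq_abs]
      calc |t - s| * ‖(↑u⁻¹ : E →L[ℂ] E)‖ ≤ |t - s| * c⁻¹ := by gcongr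
        _ < c * c⁻¹ := by gcongr
        _ = 1 := mul_inv_cancel₀ hc.ne'
    have := u.isUnit.mul (isUnit_one_sub_of_norm_lt_one hx)
    convert this using 1
    rw [mul_sub, mul_one, mul_smul_comm, u.mul_inv, hu]
    push_cast
    rw [sub_smul]
    abel
  have base : IsUnit (S + ((‖S‖ + 1 : ℝ) : ℂ) • (1 : E →L[ℂ] E)) := by
    have hpos : 0 < ‖S‖ + 1 := by positivity
    have hne : ((‖S‖ + 1 : ℝ) : ℂ) ≠ 0 := by exact_mod_cast hpos.ne'
    have hx : ‖-(((‖S‖ + 1 : ℝ) : ℂ)⁻¹ • S)‖ < 1 := by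
      rw [norm_neg, norm_smul, norm_inv, Complex.norm_real, Real.norm_of_nonneg hpos.le,
        inv_mul_lt_iff₀ hpos]
      linarith
    have := (isUnit_one_sub_of_norm_lt_one hx).smul (Units.mk0 _ hne)
    convert this using 1
    rw [Units.smul_mk0, sub_neg_eq_add, smul_add, smul_smul, mul_inv_cancel₀ hne, one_smul,
      add_comm]
  -- Descend from `‖S‖ + 1` in steps of `c / 2`. Truncating at `0` keeps the parameter where the
  -- lower bound is available and makes the descent end exactly at `S`.
  have key : ∀ n : ℕ, IsUnit (S + ((max 0 (‖S‖ + 1 - n * (c / 2)) : ℝ) : ℂ) •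
      (1 : E →L[ℂ] E)) := by
    intro n
    induction n with
    | zero =>
      have h0 : max 0 (‖S‖ + 1 - ((0 : ℕ) : ℝ) * (c / 2)) = ‖S‖ + 1 := by
        rw [Nat.cast_zero, zero_mul, sub_zero, max_eq_right (by positivity)]
      rw [h0]
      exact base
    | succ n ih =>
      refine step _ _ (le_max_left _ _) ?_ ih
      refine (abs_max_sub_max_le_max _ _ _ _).trans_lt ?_
      rw [sub_zero, abs_zero, max_lt_iff]
      refine ⟨hc, ?_⟩
      push_cast
      rw [abs_lt]
      constructor <;> linarith
  obtain ⟨n, hn⟩ := exists_nat_gt ((‖S‖ + 1) / (c / 2))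
  have hn' : ‖S‖ + 1 - n * (c / 2) ≤ 0 := by
    rw [div_lt_iff₀ (by positivity)] at hn
    linarith
  have := key n
  rwa [max_eq_left hn', Complex.ofReal_zero, zero_smul, add_zero] at this

end ContinuityMethod

/-! ### Completeness of `H_A`. -/

namespace StandardModule

variable {A : Type*} [CStarAlgebra A]

@[simp] theorem coord_sub (x y : StandardModule A) (i : ℕ) :
    (x - y).coord i = x.coord i - y.coord i := rfl

theorem norm_sum_mul_star_le (x : StandardModule A) (t : Finset ℕ) :
    ‖∑ i ∈ t, x.coord i * star (x.coord i)‖ ≤ ‖x‖ ^ 2 := by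
  let := CStarAlgebra.spectralOrder A
  have := CStarAlgebra.spectralOrderedRing A
  rw [norm_sq_eq']
  exact CStarAlgebra.norm_le_norm_of_nonneg_of_le
    (Finset.sum_nonneg fun i _ => mul_star_self_nonneg _)
    (x.summable_self.sum_le_tsum t fun i _ => mul_star_self_nonneg _)

theorem norm_coord_le (x : StandardModule A) (i : ℕ) : ‖x.coord i‖ ≤ ‖x‖ := by
  refine (sq_le_sq₀ (norm_nonneg _) (norm_nonneg _)).1 ?_
  have h := x.norm_sum_mul_star_le {i}
  rwa [Finset.sum_singleton, CStarRing.norm_self_mul_star, ← sq] at h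

theorem norm_sq_le_of_forall_sum_le {x : StandardModule A} {r : ℝ}
    (h : ∀ t : Finset ℕ, ‖∑ i ∈ t, x.coord i * star (x.coord i)‖ ≤ r) : ‖x‖ ^ 2 ≤ r := by
  rw [norm_sq_eq']
  exact le_of_tendsto x.summable_self.hasSum.norm (.of_forall h)

/-- By the parallelogram identity, `(x + y)(x + y)* ≤ 2 x x* + 2 y y*`, and the norm is monotone on
positive elements. -/
theorem norm_sum_add_mul_star_le (x y : ℕ → A) (t : Finset ℕ) :
    ‖∑ i ∈ t, (x i + y i) * star (x i + y i)‖ ≤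
      2 * ‖∑ i ∈ t, x i * star (x i)‖ + 2 * ‖∑ i ∈ t, y i * star (y i)‖ := by
  let := CStarAlgebra.spectralOrder A
  have := CStarAlgebra.spectralOrderedRing A
  have h : ∑ i ∈ t, (x i + y i) * star (x i + y i) ≤
      (∑ i ∈ t, x i * star (x i) + ∑ i ∈ t, y i * star (y i)) +
      (∑ i ∈ t, x i * star (x i) + ∑ i ∈ t, y i * star (y i)) := by
    rw [← Finset.sum_add_distrib, ← Finset.sum_add_distrib]
    refine Finset.sum_le_sum fun i _ => ?_
    have h := mul_star_self_nonneg (x i - y i)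
    rw [← sub_nonneg]
    convert h using 1
    simp only [star_add, star_sub]
    noncomm_ring
  refine (CStarAlgebra.norm_le_norm_of_nonneg_of_le
    (Finset.sum_nonneg fun i _ => mul_star_self_nonneg _) h).trans ?_
  have h1 := norm_add_le (∑ i ∈ t, x i * star (x i)) (∑ i ∈ t, y i * star (y i))
  have h2 := norm_add_le (∑ i ∈ t, x i * star (x i) + ∑ i ∈ t, y i * star (y i))
    (∑ i ∈ t, x i * star (x i) + ∑ i ∈ t, y i * star (y i))
  linarith

-- As for scalar `ℓ²`: coordinates converge, and the Cauchy bounds on finite partial sums, uniform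
-- in the finite set, survive the coordinatewise limit. They give both membership of the limit in
-- `H_A` and convergence in norm.
open Filter Topology in
instance : CompleteSpace (StandardModule A) := by
  refine Metric.complete_of_cauchySeq_tendsto fun u hu => ?_
  have hcoord : ∀ i, CauchySeq fun k => (u k).coord i := by
    intro i
    rw [Metric.cauchySeq_iff'] at hu ⊢
    intro ε hε
    obtain ⟨N, hN⟩ := hu ε hε
    refine ⟨N, fun n hn => lt_of_le_of_lt ?_ (hN n hn)⟩
    rw [dist_eq_norm, dist_eq_norm, ← coord_sub]
    exact norm_coord_le _ i
  choose y hy using fun i => cauchySeq_tendsto_of_complete (hcoord i)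
  have hunif : ∀ ε > 0, ∃ N, ∀ n ≥ N, ∀ t : Finset ℕ,
      ‖∑ i ∈ t, (y i - (u n).coord i) * star (y i - (u n).coord i)‖ ≤ ε ^ 2 := by
    intro ε hε
    obtain ⟨N, hN⟩ := Metric.cauchySeq_iff.1 hu ε hε
    refine ⟨N, fun n hn t => ?_⟩
    have hlim : Tendsto (fun m => ‖∑ i ∈ t, ((u m).coord i - (u n).coord i) *
        star ((u m).coord i - (u n).coord i)‖) atTop
        (𝓝 ‖∑ i ∈ t, (y i - (u n).coord i) * star (y i - (u n).coord i)‖) := by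
      refine (tendsto_finsetSum _ fun i _ => ?_).norm
      exact ((hy i).sub_const _).mul ((hy i).sub_const _).star
    refine le_of_tendsto hlim ((eventually_ge_atTop N).mono fun m hm => ?_)
    refine (norm_sum_mul_star_le (u m - u n) t).trans ?_
    have := (hN m hm n hn).le
    rw [dist_eq_norm] at this
    gcongr
  have hsum : Summable fun i => y i * star (y i) := by
    rw [summable_iff_vanishing_norm]
    intro ε hε
    obtain ⟨N, hN⟩ := hunif (√(ε / 8)) (by positivity)
    obtain ⟨s, hs⟩ := summable_iff_vanishing_norm.1 (u N).summable_self (ε / 8) (by positivity)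
    refine ⟨s, fun t ht => ?_⟩
    have h1 := hN N le_rfl t
    rw [Real.sq_sqrt (by positivity)] at h1
    have h2 := norm_sum_add_mul_star_le (fun i => y i - (u N).coord i) (u N).coord t
    have h3 := hs t ht
    simp only [sub_add_cancel] at h2
    linarith
  obtain ⟨z, hz⟩ : ∃ z : StandardModule A, ∀ i, z.coord i = y i := ⟨⟨y, hsum⟩, fun _ => rfl⟩
  refine ⟨z, Metric.tendsto_atTop.2 fun ε hε => ?_⟩
  obtain ⟨N, hN⟩ := hunif (ε / 2) (by positivity)
  refine ⟨N, fun n hn => ?_⟩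
  rw [dist_comm, dist_eq_norm]
  refine lt_of_le_of_lt ((sq_le_sq₀ (norm_nonneg _) (by positivity)).1
    (norm_sq_le_of_forall_sum_le fun t => ?_)) (half_lt_self hε)
  simpa [hz] using hN n hn t

end StandardModule

/-! ### Standard basis vectors and tail projections. -/

namespace StandardModule

variable {A : Type*} [CStarAlgebra A]

/-- The `i`-th standard basis vector of `H_A`. -/
def single (A : Type*) [CStarAlgebra A] (i : ℕ) : StandardModule A :=
  (⟨Pi.single i 1, summable_of_ne_finset_zero (s := {i}) fun j hj => by
    rw [Pi.single_eq_of_ne (by simpa using hj), zero_mul]⟩ : standardSubmodule A)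

theorem coord_single (i j : ℕ) : (single A i).coord j = if j = i then 1 else 0 := by
  change (Pi.single i 1 : ℕ → A) j = _
  rw [Pi.single_apply]

theorem inner_single_left (i : ℕ) (x : StandardModule A) : ⟪single A i, x⟫_A = x.coord i := by
  rw [inner_def, tsum_eq_single i fun j hj => by simp [coord_single, hj]]
  simp [coord_single]

theorem coord_sum {ι : Type*} (s : Finset ι) (f : ι → StandardModule A) (j : ℕ) :
    (∑ i ∈ s, f i).coord j = ∑ i ∈ s, (f i).coord j :=
  map_sum (AddMonoidHom.mk' (fun x : StandardModule A => x.coord j) fun _ _ => rfl) f s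

end StandardModule

section Truncation

open StandardModule

variable {A : Type*} [CStarAlgebra A]

variable (A) in
/-- The projection of `H_A` onto the sequences vanishing at the first `n` places. -/
noncomputable def tailProjection (n : ℕ) : AdjointableOperators A :=
  1 - ∑ i ∈ Finset.range n, elementaryOperator (single A i) (single A i)

theorem tailProjection_apply (n : ℕ) (x : StandardModule A) :
    (tailProjection A n).1 x = x - ∑ i ∈ Finset.range n, x.coord i • single A i := by
  have h : (tailProjection A n).1 =
      1 - ∑ i ∈ Finset.range n, elementaryCLM (single A i) (single A i) := by
    simp [tailProjection, elementaryOperator]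
  simp [h, inner_single_left]

theorem coord_tailProjection (n : ℕ) (x : StandardModule A) (j : ℕ) :
    ((tailProjection A n).1 x).coord j = if j < n then 0 else x.coord j := by
  rw [tailProjection_apply, coord_sub, coord_sum]
  simp only [coord_smul, coord_single, mul_ite, mul_one, mul_zero, Finset.sum_ite_eq,
    Finset.mem_range]
  split_ifs <;> simp

theorem inner_tailProjection (n : ℕ) (x y : StandardModule A) :
    ⟪(tailProjection A n).1 x, y⟫_A = ⟪x, (tailProjection A n).1 y⟫_A := by
  rw [inner_def, inner_def]
  refine tsum_congr fun j => ?_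
  rw [coord_tailProjection, coord_tailProjection]
  split_ifs <;> simp

theorem tailProjection_tailProjection (n : ℕ) (x : StandardModule A) :
    (tailProjection A n).1 ((tailProjection A n).1 x) = (tailProjection A n).1 x := by
  ext j
  simp only [coord_tailProjection]
  split_ifs <;> rfl

theorem sum_coord_tailProjection (n : ℕ) (x : StandardModule A) (t : Finset ℕ) :
    ∑ j ∈ t, ((tailProjection A n).1 x).coord j * star (((tailProjection A n).1 x).coord j) =
      ∑ j ∈ t with n ≤ j, x.coord j * star (x.coord j) := by
  rw [Finset.sum_filter]
  refine Finset.sum_congr rfl fun j _ => ?_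
  rw [coord_tailProjection]
  by_cases h : j < n
  · simp [h]
  · simp [h, not_lt.1 h]

theorem norm_tailProjection_apply_le (n : ℕ) (x : StandardModule A) :
    ‖(tailProjection A n).1 x‖ ≤ ‖x‖ := by
  refine (sq_le_sq₀ (norm_nonneg _) (norm_nonneg _)).1 (norm_sq_le_of_forall_sum_le fun t => ?_)
  rw [sum_coord_tailProjection]
  exact norm_sum_mul_star_le _ _

theorem norm_tailProjection_le (n : ℕ) : ‖tailProjection A n‖ ≤ 1 :=
  ContinuousLinearMap.opNorm_le_bound _ zero_le_one fun x => by
    rw [one_mul]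
    exact norm_tailProjection_apply_le n x

open Filter Topology

theorem tendsto_tailProjection_apply (x : StandardModule A) :
    Tendsto (fun n => (tailProjection A n).1 x) atTop (𝓝 0) := by
  refine Metric.tendsto_atTop.2 fun ε hε => ?_
  obtain ⟨s, hs⟩ := summable_iff_vanishing_norm.1 x.summable_self ((ε / 2) ^ 2) (by positivity)
  -- Indices `j ≥ n` exceed every element of `s`, so the remaining sum is disjoint from `s`.
  refine ⟨s.sup id + 1, fun n hn => ?_⟩
  rw [dist_zero_right]
  refine lt_of_le_of_lt ((sq_le_sq₀ (norm_nonneg _) (by positivity)).1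
    (norm_sq_le_of_forall_sum_le fun t => ?_)) (half_lt_self hε)
  rw [sum_coord_tailProjection]
  refine (hs _ (Finset.disjoint_left.2 fun j hj hjs => ?_)).le
  have h1 := (Finset.mem_filter.1 hj).2
  have h2 : j ≤ s.sup id := Finset.le_sup (f := id) hjs
  omega

theorem norm_elementaryOperator_le (x y : StandardModule A) :
    ‖elementaryOperator x y‖ ≤ ‖y‖ * ‖x‖ :=
  ContinuousLinearMap.opNorm_le_bound _ (by positivity) fun z => by
    change ‖⟪y, z⟫_A • x‖ ≤ _
    calc ‖⟪y, z⟫_A • x‖ ≤ ‖⟪y, z⟫_A‖ * ‖x‖ := norm_smul_le' _ _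
      _ ≤ (‖y‖ * ‖z‖) * ‖x‖ := by gcongr; exact norm_inner_le' _ _
      _ = ‖y‖ * ‖x‖ * ‖z‖ := by ring

theorem elementaryOperator_mul_tailProjection (x y : StandardModule A) (n : ℕ) :
    elementaryOperator x y * tailProjection A n =
      elementaryOperator x ((tailProjection A n).1 y) := by
  refine Subtype.ext <| ContinuousLinearMap.ext fun z => ?_
  change ⟪y, (tailProjection A n).1 z⟫_A • x = ⟪(tailProjection A n).1 y, z⟫_A • x
  rw [inner_tailProjection]

/-- Since the tail projection `Q` is self-adjoint, `θ_{x,y} Q = θ_{x,Q y}`. Thus strong convergence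
of `Q` to zero becomes norm convergence after multiplication by a finite-rank operator on the left.
-/
theorem tendsto_span_mul_tailProjection {L : AdjointableOperators A}
    (hL : L ∈ Submodule.span ℂ
      {T | ∃ x y : StandardModule A, T = elementaryOperator x y}) :
    Tendsto (fun n => L * tailProjection A n) atTop (𝓝 0) := by
  induction hL using Submodule.span_induction with
  | mem T hT =>
    obtain ⟨x, y, rfl⟩ := hT
    simp only [elementaryOperator_mul_tailProjection]
    refine squeeze_zero_norm (fun n => norm_elementaryOperator_le _ _) ?_
    simpa using (tendsto_tailProjection_apply y).norm.mul_const ‖x‖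
  | zero => simp
  | add S T _ _ hS hT => simpa [add_mul] using hS.add hT
  | smul c T _ hT => simpa using hT.const_smul c

theorem exists_norm_mul_tailProjection_lt_one {K : AdjointableOperators A}
    (hK : K ∈ CompactOperators A) : ∃ n, ‖K * tailProjection A n‖ < 1 := by
  obtain ⟨L, hL, hKL⟩ := Metric.mem_closure_iff.1 (show K ∈ closure _ from hK) 2⁻¹ (by norm_num)
  obtain ⟨n, hn⟩ := ((tendsto_zero_iff_norm_tendsto_zero.1
    (tendsto_span_mul_tailProjection hL)).eventually_lt_const
      (show (0 : ℝ) < 2⁻¹ by norm_num)).exists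
  rw [dist_eq_norm] at hKL
  refine ⟨n, ?_⟩
  calc ‖K * tailProjection A n‖ = ‖(K - L) * tailProjection A n + L * tailProjection A n‖ := by
        rw [← add_mul, sub_add_cancel]
    _ ≤ ‖(K - L) * tailProjection A n‖ + ‖L * tailProjection A n‖ := norm_add_le _ _
    _ < 2⁻¹ + 2⁻¹ := by
        refine add_lt_add (lt_of_le_of_lt ((norm_mul_le _ _).trans
          (mul_le_mul_of_nonneg_left (norm_tailProjection_le n) (norm_nonneg _))) ?_) hn
        rw [mul_one]
        exact hKL
    _ = 1 := by norm_num

end Truncation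

/-! ### From a left inverse modulo compacts to the decompositions. -/

section Sufficiency

variable {A : Type*} [CStarAlgebra A]

/-- An adjointable operator as a continuous `A`-linear map. -/
noncomputable def adjointableCLM (T : AdjointableOperators A) :
    StandardModule A →L[A] StandardModule A where
  toFun := T.1
  map_add' := T.1.map_add
  map_smul' := T.2.map_smul
  cont := T.1.continuous

/-- If `D` is an outer inverse of `F` and `D ∘ F` has finitely generated kernel, then `F` is upper
semi-Fredholm. -/
theorem isUpperSemiFredholm_of_outer_inverse (F : AdjointableOperators A)
    (D : StandardModule A →L[A] StandardModule A) (hD : ∀ x, D (F.1 (D x)) = D x)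
    (hfg : (D.toLinearMap ∘ₗ (adjointableCLM F).toLinearMap).ker.FG) : IsUpperSemiFredholm F := by
  set p₁ : StandardModule A →ₗ[A] StandardModule A := D.toLinearMap ∘ₗ (adjointableCLM F).toLinearMap with h₁
  set p₂ : StandardModule A →ₗ[A] StandardModule A := (adjointableCLM F).toLinearMap ∘ₗ D.toLinearMap with h₂
  have hp₁ : ∀ x, p₁ x = D (F.1 x) := fun _ => rfl
  have hp₂ : ∀ x, p₂ x = F.1 (D x) := fun _ => rfl
  have hc₁ : Continuous p₁ := D.continuous.comp F.1.continuous
  have hc₂ : Continuous p₂ := F.1.continuous.comp D.continuous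
  have hi₁ : IsIdempotentElem p₁ := LinearMap.ext fun x => by
    simp [hp₁, hD]
  have hi₂ : IsIdempotentElem p₂ := LinearMap.ext fun x => by
    simp [hp₂, hD]
  have hr₁ : ∀ x, x ∈ p₁.range ↔ p₁ x = x := fun x => by
    rw [LinearMap.IsIdempotentElem.mem_range_iff hi₁]
  have hr₂ : ∀ x, x ∈ p₂.range ↔ p₂ x = x := fun x => by
    rw [LinearMap.IsIdempotentElem.mem_range_iff hi₂]
  -- `D F D = D` makes `D F` and `F D` idempotent, and `D` inverts `F` between their ranges. No
  -- adjoint of `D` is needed.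
  refine ⟨p₁.range, p₁.ker, p₂.range, p₂.ker, ?_, ?_, ?_, ?_,
    LinearMap.IsIdempotentElem.isCompl hi₁, LinearMap.IsIdempotentElem.isCompl hi₂, hfg,
    ⟨⟨⟨⟨⟨fun x => ⟨F.1 x, ?_⟩, ?_⟩, ?_⟩, fun x => ⟨D x, ?_⟩, ?_, ?_⟩, ?_, ?_⟩, fun x => rfl⟩, ?_⟩
  · convert isClosed_eq hc₁ continuous_id
    exact Set.ext hr₁
  · convert isClosed_eq hc₁ continuous_const
    exact Set.ext fun x => LinearMap.mem_ker
  · convert isClosed_eq hc₂ continuous_id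
    exact Set.ext hr₂
  · convert isClosed_eq hc₂ continuous_const
    exact Set.ext fun x => LinearMap.mem_ker
  · rw [hr₂, hp₂, ← hp₁, (hr₁ _).1 x.2]
  · intro x y
    exact Subtype.ext (F.1.map_add _ _)
  · intro a x
    exact Subtype.ext (F.2.map_smul _ _)
  · rw [hr₁, hp₁, hD]
  · intro x
    exact Subtype.ext ((hr₁ _).1 x.2)
  · intro x
    exact Subtype.ext ((hr₂ _).1 x.2)
  · exact (F.1.continuous.comp continuous_subtype_val).subtype_mk _
  · exact (D.continuous.comp continuous_subtype_val).subtype_mk _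
  · intro x hx
    rw [LinearMap.mem_ker, hp₁] at hx
    rw [LinearMap.mem_ker, hp₂, hx, map_zero]

theorem isUpperSemiFredholm_of_left_inverse_mod_compact {F D K : AdjointableOperators A}
    (hK : K ∈ CompactOperators A) (h : D * F = 1 + K) : IsUpperSemiFredholm F := by
  classical
  obtain ⟨n, hn⟩ := exists_norm_mul_tailProjection_lt_one hK
  set Q := tailProjection A n
  have hQQ : ∀ x, Q.1 (Q.1 x) = Q.1 x := tailProjection_tailProjection n
  set R := Q * (K * Q)
  have hR : ‖-R.1‖ < 1 := by
    rw [norm_neg]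
    calc ‖R‖ ≤ ‖Q‖ * ‖K * Q‖ := norm_mul_le _ _
      _ ≤ 1 * ‖K * Q‖ := by gcongr; exact norm_tailProjection_le n
      _ < 1 := by rwa [one_mul]
  obtain ⟨u, hu⟩ := isUnit_one_sub_of_norm_lt_one hR
  set S : StandardModule A →L[ℂ] StandardModule A := ↑u⁻¹
  have hux : ∀ x, u.1 x = x + R.1 x := fun x => by rw [hu]; simp
  have hSu : ∀ x, S (u.1 x) = x := fun x => congrArg (fun T => T x) u.inv_mul
  have huS : ∀ x, u.1 (S x) = x := fun x => congrArg (fun T => T x) u.mul_inv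
  -- The inverse was taken among `ℂ`-linear operators; it is `A`-linear because `1 + R` is.
  have hS : ∀ (a : A) x, S (a • x) = a • S x := fun a x => by
    rw [← hSu (a • S x), hux, R.2.map_smul, ← smul_add, ← hux, huS]
  let D' : StandardModule A →L[A] StandardModule A :=
    { toFun := fun x => Q.1 (S (Q.1 (D.1 x)))
      map_add' := fun x y => by simp
      map_smul' := fun a x => by simp [D.2.map_smul, Q.2.map_smul, hS]
      cont := Q.1.continuous.comp (S.continuous.comp (Q.1.continuous.comp D.1.continuous)) }
  have hDF : ∀ x, D.1 (F.1 x) = x + K.1 x := fun x =>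
    congrArg (fun T : AdjointableOperators A => T.1 x) h
  have hD'F : ∀ x, D' (F.1 (Q.1 x)) = Q.1 x := fun x => by
    change Q.1 (S (Q.1 (D.1 (F.1 (Q.1 x))))) = Q.1 x
    -- `Q D F Q = Q + Q K Q = (1 + R) Q`, so `S` cancels the compact perturbation.
    have h1 : Q.1 (D.1 (F.1 (Q.1 x))) = u.1 (Q.1 x) := by
      rw [hDF, map_add, hQQ, hux]
      change _ = Q.1 x + Q.1 (K.1 (Q.1 (Q.1 x)))
      rw [hQQ]
    rw [h1, hSu, hQQ]
  have hQD' : ∀ x, Q.1 (D' x) = D' x := fun x => hQQ _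
  refine isUpperSemiFredholm_of_outer_inverse F D' (fun x => by rw [← hQD' x, hD'F]) ?_
  -- Split `x` into its tail `Q x` and its head `P`. As `D' F` fixes `Q x`, membership in the kernel
  -- forces `Q x = -D' F P`, so `x = P - D' F P`. Conversely, `D' F` fixes every value of `D'`.
  have hker : (D'.toLinearMap ∘ₗ (adjointableCLM F).toLinearMap).ker = Submodule.span A
      (((Finset.range n).image fun i => StandardModule.single A i -
        D' (F.1 (StandardModule.single A i)) : Finset _) : Set (StandardModule A)) := by
    apply le_antisymm
    · intro x hx
      have hx' : D' (F.1 x) = 0 := hx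
      set P := ∑ i ∈ Finset.range n, x.coord i • StandardModule.single A i with hP
      have hxP : x = Q.1 x + P := by rw [tailProjection_apply, sub_add_cancel]
      have h1 : x = P - D' (F.1 P) := by
        have h2 : D' (F.1 x) = Q.1 x + D' (F.1 P) := by
          conv_lhs => rw [hxP]
          rw [map_add, map_add, hD'F]
        have h3 : Q.1 x = - D' (F.1 P) := eq_neg_of_add_eq_zero_left (h2.symm.trans hx')
        conv_lhs => rw [hxP, h3]
        abel
      rw [h1, hP, map_sum, map_sum, ← Finset.sum_sub_distrib]
      refine Submodule.sum_mem _ fun i hi => ?_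
      rw [F.2.map_smul, map_smul, ← smul_sub]
      exact Submodule.smul_mem _ _
        (Submodule.subset_span (Finset.mem_coe.2 (Finset.mem_image_of_mem _ hi)))
    · rw [Submodule.span_le]
      intro y hy
      obtain ⟨i, -, rfl⟩ := Finset.mem_image.1 (Finset.mem_coe.1 hy)
      change D' (F.1 (_ - _)) = 0
      rw [map_sub, map_sub, ← hQD' (F.1 (StandardModule.single A i)), hD'F, sub_self]
  exact ⟨_, hker.symm⟩

end Sufficiency

/-! ### Order estimates and bounded coefficients. -/

namespace StandardModule

variable {A : Type*} [CStarAlgebra A]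

-- Each summand is dominated by the whole positive sum. The nonnegative term in `t` is the shift of
-- the method of continuity, harmless for lower bounds.
open scoped ComplexOrder in
theorem norm_le_norm_sum_inner_self_add {ι : Type*} (s : Finset ι) (y : ι → StandardModule A)
    {i : ι} (hi : i ∈ s) (x : StandardModule A) {t : ℝ} (ht : 0 ≤ t) :
    ‖y i‖ ^ 2 ≤ ‖∑ i ∈ s, ⟪y i, y i⟫_A + (t : ℂ) • ⟪x, x⟫_A‖ := by
  let := CStarAlgebra.spectralOrder A
  have := CStarAlgebra.spectralOrderedRing A
  have h0 : ∀ z : StandardModule A, 0 ≤ ⟪z, z⟫_A := fun z =>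
    tsum_nonneg fun i => mul_star_self_nonneg _
  have ht' : 0 ≤ (t : ℂ) • ⟪x, x⟫_A := smul_nonneg (by exact_mod_cast ht) (h0 x)
  rw [norm_sq_eq']
  refine CStarAlgebra.norm_le_norm_of_nonneg_of_le (h0 _) ?_
  exact (Finset.single_le_sum (fun j _ => h0 (y j)) hi).trans (le_add_of_nonneg_right ht')

open scoped ComplexOrder in
theorem norm_sq_le_norm_sum_mul_star_add {ι : Type*} (s : Finset ι) (a : ι → A)
    {i : ι} (hi : i ∈ s) (x : StandardModule A) {t : ℝ} (ht : 0 ≤ t) :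
    ‖a i‖ ^ 2 ≤ ‖∑ i ∈ s, a i * star (a i) + (t : ℂ) • ⟪x, x⟫_A‖ := by
  let := CStarAlgebra.spectralOrder A
  have := CStarAlgebra.spectralOrderedRing A
  have ht' : 0 ≤ (t : ℂ) • ⟪x, x⟫_A :=
    smul_nonneg (by exact_mod_cast ht) (tsum_nonneg fun i => mul_star_self_nonneg _)
  rw [sq, ← CStarRing.norm_self_mul_star]
  refine CStarAlgebra.norm_le_norm_of_nonneg_of_le (mul_star_self_nonneg _) ?_
  exact (Finset.single_le_sum (fun j _ => mul_star_self_nonneg (a j)) hi).trans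
    (le_add_of_nonneg_right ht')

/-- Cauchy–Schwarz turns a quadratic-form estimate into a lower bound for an operator. -/
theorem mul_norm_le_of_mul_norm_sq_le_inner {c : ℝ} {x z : StandardModule A}
    (h : c * ‖x‖ ^ 2 ≤ ‖⟪z, x⟫_A‖) : c * ‖x‖ ≤ ‖z‖ := by
  rcases (norm_nonneg x).eq_or_lt with h0 | h0
  · rw [← h0, mul_zero]
    exact norm_nonneg z
  · have := h.trans (norm_inner_le' z x)
    rw [sq, ← mul_assoc] at this
    exact le_of_mul_le_mul_right this h0

theorem inner_sum_left {ι : Type*} (s : Finset ι) (f : ι → StandardModule A)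
    (y : StandardModule A) : ⟪∑ i ∈ s, f i, y⟫_A = ∑ i ∈ s, ⟪f i, y⟫_A :=
  map_sum (AddMonoidHom.mk' (fun x : StandardModule A => ⟪x, y⟫_A) fun _ _ => by simp) f s

theorem inner_sum_right {ι : Type*} (s : Finset ι) (f : ι → StandardModule A)
    (y : StandardModule A) : ⟪y, ∑ i ∈ s, f i⟫_A = ∑ i ∈ s, ⟪y, f i⟫_A :=
  map_sum (AddMonoidHom.mk' (fun x : StandardModule A => ⟪y, x⟫_A) fun _ _ => by simp) f s

/-- The map `a ↦ a • x` as a bounded operator. -/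
noncomputable def smulRightCLM (x : StandardModule A) : A →L[ℂ] StandardModule A :=
  LinearMap.mkContinuous
    { toFun := fun a => a • x
      map_add' := fun a b => add_smul a b x
      map_smul' := fun c a => smul_assoc c a x }
    ‖x‖ fun a => by
      rw [mul_comm]
      exact norm_smul_le' a x

@[simp] theorem smulRightCLM_apply (x : StandardModule A) (a : A) : smulRightCLM x a = a • x := rfl

/-- Elements of a closed finitely generated submodule have coefficients of controlled norm. -/
theorem exists_bounded_coefficients {k : ℕ} (n : Fin k → StandardModule A)
    (hcl : IsClosed (Submodule.span A (Set.range n) : Set (StandardModule A))) :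
    ∃ C > 0, ∀ y ∈ Submodule.span A (Set.range n), ∃ a : Fin k → A,
      ∑ i, a i • n i = y ∧ ∀ i, ‖a i‖ ≤ C * ‖y‖ := by
  set V := (Submodule.span A (Set.range n)).restrictScalars ℂ
  have : CompleteSpace V := IsClosed.completeSpace_coe (hs := hcl)
  let T₀ : (Fin k → A) →L[ℂ] StandardModule A :=
    ∑ i, (smulRightCLM (n i)).comp (ContinuousLinearMap.proj i)
  have hT₀ : ∀ a, T₀ a = ∑ i, a i • n i := fun a => by simp [T₀]
  let T : (Fin k → A) →L[ℂ] V := T₀.codRestrict V fun a => by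
    rw [hT₀]
    exact Submodule.sum_mem _ fun i _ =>
      Submodule.smul_mem _ _ (Submodule.subset_span (Set.mem_range_self i))
  have hT : Function.Surjective T := by
    rintro ⟨y, hy⟩
    obtain ⟨a, ha⟩ := (Submodule.mem_span_range_iff_exists_fun A).1 hy
    exact ⟨a, Subtype.ext ((hT₀ a).trans ha)⟩
  -- Closedness makes the submodule a Banach space, so the open mapping theorem applies to the
  -- surjection from `A ^ k`.
  obtain ⟨C, hC, h⟩ := T.exists_preimage_norm_le hT
  refine ⟨C, hC, fun y hy => ?_⟩
  obtain ⟨a, ha, hay⟩ := h ⟨y, hy⟩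
  exact ⟨a, (hT₀ a).symm.trans (congrArg Subtype.val ha), fun i => (norm_le_pi_norm a i).trans hay⟩

end StandardModule

/-! ### From the decompositions to a left inverse modulo compacts. -/

section Necessity

open StandardModule

variable {A : Type*} [CStarAlgebra A]

theorem elementaryOperator_mem_compactOperators (x y : StandardModule A) :
    elementaryOperator x y ∈ CompactOperators A :=
  subset_closure (Submodule.subset_span ⟨x, y, rfl⟩)

/-- A closed finitely generated submodule of `H_A` is the range of a compact orthogonal
projection. -/
theorem exists_compact_projection {N : Submodule A (StandardModule A)} (hN : N.FG)
    (hcl : IsClosed (N : Set (StandardModule A))) :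
    ∃ P : AdjointableOperators A, P ∈ CompactOperators A ∧ (∀ x, P.1 x ∈ N) ∧
      (∀ x ∈ N, P.1 x = x) ∧ ∀ x y, ⟪P.1 x, y⟫_A = ⟪x, P.1 y⟫_A := by
  obtain ⟨k, n, rfl⟩ := Submodule.fg_iff_exists_fin_generating_family.1 hN
  obtain ⟨C, hC, hcoef⟩ := exists_bounded_coefficients n hcl
  set N := Submodule.span A (Set.range n)
  set V := N.restrictScalars ℂ
  have : CompleteSpace V := IsClosed.completeSpace_coe (hs := hcl)
  -- The frame operator of the generators; the projection will be its inverse on `N` composed with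
  -- it.
  let S : AdjointableOperators A := ∑ i, elementaryOperator (n i) (n i)
  have hSx : ∀ x, S.1 x = ∑ i, ⟪n i, x⟫_A • n i := fun x => by
    have h : S.1 = ∑ i, elementaryCLM (n i) (n i) := by
      simp [S, elementaryOperator]
    simp [h]
  have hSN : ∀ x, S.1 x ∈ V := fun x => by
    rw [hSx]
    exact Submodule.sum_mem _ fun i _ =>
      Submodule.smul_mem _ _ (Submodule.subset_span (Set.mem_range_self i))
  have hSsymm : ∀ x y, ⟪S.1 x, y⟫_A = ⟪x, S.1 y⟫_A := fun x y => by
    rw [hSx, hSx, inner_sum_left, inner_sum_right]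
    simp
  let S₁ : V →L[ℂ] V := (S.1.comp V.subtypeL).codRestrict V fun x => hSN x
  have hS₁ : ∀ x : V, (S₁ x : StandardModule A) = S.1 x := fun _ => rfl
  -- With `B = ⟪S x + t x, x⟫`, each `‖⟪n i, x⟫‖` is at most `√‖B‖`. Expanding one copy of `x` in
  -- `⟪x, x⟫` with bounded coefficients gives `‖x‖ ≤ C k √‖B‖`; the added `1` keeps the constant
  -- positive when `k = 0`.
  have hbound : ∀ t : ℝ, 0 ≤ t → ∀ x : V, ((C * k + 1) ^ 2)⁻¹ * ‖x‖ ≤ ‖S₁ x + (t : ℂ) • x‖ := by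
    intro t ht x
    refine mul_norm_le_of_mul_norm_sq_le_inner (x := (x : StandardModule A))
      (z := S.1 x + (t : ℂ) • (x : StandardModule A)) ?_
    rw [inv_mul_le_iff₀ (by positivity)]
    set B := ⟪S.1 x + (t : ℂ) • (x : StandardModule A), (x : StandardModule A)⟫_A with hB
    have hB' : B = ∑ i, ⟪n i, (x : StandardModule A)⟫_A * star ⟪n i, (x : StandardModule A)⟫_A +
        (t : ℂ) • ⟪(x : StandardModule A), (x : StandardModule A)⟫_A := by
      rw [hB, inner_add_left', inner_smul_left_complex', hSx, inner_sum_left]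
      simp
    have hi : ∀ i, ‖⟪n i, (x : StandardModule A)⟫_A‖ ≤ √‖B‖ := fun i => by
      refine Real.le_sqrt_of_sq_le ?_
      rw [hB']
      exact norm_sq_le_norm_sum_mul_star_add Finset.univ
        (fun i => ⟪n i, (x : StandardModule A)⟫_A) (Finset.mem_univ i) _ ht
    obtain ⟨a, ha, hay⟩ := hcoef x x.2
    have hx : ‖(x : StandardModule A)‖ ≤ (C * k + 1) * √‖B‖ := by
      have h1 : ‖(x : StandardModule A)‖ * ‖(x : StandardModule A)‖ ≤
          ((C * k + 1) * √‖B‖) * ‖(x : StandardModule A)‖ := by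
        calc ‖(x : StandardModule A)‖ * ‖(x : StandardModule A)‖
            = ‖⟪(x : StandardModule A), (x : StandardModule A)⟫_A‖ := by rw [← norm_sq_eq', sq]
          _ = ‖⟪∑ i, a i • n i, (x : StandardModule A)⟫_A‖ := by rw [ha]
          _ ≤ ∑ i : Fin k, √‖B‖ * (C * ‖(x : StandardModule A)‖) := by
            rw [inner_sum_left]
            refine norm_sum_le_of_le _ fun i _ => ?_
            rw [inner_smul_left']
            refine (norm_mul_le _ _).trans ?_
            rw [norm_star]
            gcongr
            · exact hi i
            · exact hay i
          _ = (C * k * √‖B‖) * ‖(x : StandardModule A)‖ := by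
            rw [Finset.sum_const, Finset.card_univ, Fintype.card_fin, nsmul_eq_mul]
            ring
          _ ≤ ((C * k + 1) * √‖B‖) * ‖(x : StandardModule A)‖ := by
            gcongr
            linarith
      rcases (norm_nonneg (x : StandardModule A)).eq_or_lt with h0 | h0
      · rw [← h0]
        positivity
      · exact le_of_mul_le_mul_right h1 h0
    calc ‖(x : StandardModule A)‖ ^ 2 ≤ ((C * k + 1) * √‖B‖) ^ 2 := by gcongr
      _ = (C * k + 1) ^ 2 * ‖B‖ := by rw [mul_pow, Real.sq_sqrt (norm_nonneg _)]
  obtain ⟨u, hu⟩ := isUnit_of_forall_add_smul_bounded_below S₁ (by positivity) hbound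
  set R : V →L[ℂ] V := ↑u⁻¹
  have hRS : ∀ x, R (S₁ x) = x := fun x => by
    rw [← hu]
    exact congrArg (fun T : V →L[ℂ] V => T x) u.inv_mul
  have hSR : ∀ x : V, S.1 (R x) = x := fun x => by
    rw [← hS₁, ← hu]
    exact congrArg (fun T : V →L[ℂ] V => (T x : StandardModule A)) u.mul_inv
  let S₂ : StandardModule A →L[ℂ] V := S.1.codRestrict V hSN
  let P₀ : StandardModule A →L[ℂ] V := R.comp S₂
  have hP₀ : ∀ x : V, P₀ x = x := fun x => hRS x
  have hSP₀ : ∀ x, S.1 (P₀ x) = S.1 x := fun x => hSR (S₂ x)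
  -- Write `x = S (R x)`, move `S` across, and use `S P₀ = S`.
  have hortho : ∀ (x : V) y, ⟪(x : StandardModule A), (P₀ y : StandardModule A)⟫_A =
      ⟪(x : StandardModule A), y⟫_A := fun x y => by
    rw [← hSR x, hSsymm, hSP₀, ← hSsymm]
  have hortho' : ∀ x (y : V), ⟪(P₀ x : StandardModule A), (y : StandardModule A)⟫_A =
      ⟪x, (y : StandardModule A)⟫_A := fun x y => by
    rw [← star_inner', hortho, star_inner']
  have hRsymm : ∀ x y : V, ⟪(R x : StandardModule A), (y : StandardModule A)⟫_A =
      ⟪(x : StandardModule A), (R y : StandardModule A)⟫_A := fun x y => by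
    conv_lhs => rw [← hSR y]
    rw [← hSsymm, hSR]
  let P : AdjointableOperators A := ⟨V.subtypeL.comp P₀, V.subtypeL.comp P₀, fun x y =>
    ((hortho (P₀ x) y).symm.trans (hortho' x (P₀ y)))⟩
  -- `R` lives only on `N`. Extended by `R P₀` it is adjointable on all of `H_A`, and `P = R' S`
  -- lies in the ideal because `S` does.
  let R' : AdjointableOperators A := ⟨V.subtypeL.comp (R.comp P₀), V.subtypeL.comp (R.comp P₀),
    fun x y => (hortho (R (P₀ x)) y).symm.trans
      ((hRsymm (P₀ x) (P₀ y)).trans (hortho' x (R (P₀ y))))⟩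
  have hP : P = R' * S := by
    refine Subtype.ext <| ContinuousLinearMap.ext fun x => ?_
    change (R (S₂ x) : StandardModule A) = R (P₀ (S₂ x))
    rw [hP₀]
  refine ⟨P, ?_, fun x => (P₀ x).2, fun x hx => congrArg Subtype.val (hP₀ ⟨x, hx⟩), fun x y =>
    ((hortho (P₀ x) y).symm.trans (hortho' x (P₀ y)))⟩
  rw [hP]
  exact Ideal.mul_mem_left _ _
    (Ideal.sum_mem _ fun i _ => elementaryOperator_mem_compactOperators _ _)

/-- The projection along a closed complement is bounded. -/
theorem exists_norm_le_mul_norm_add {M N : Submodule A (StandardModule A)}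
    (hM : IsClosed (M : Set (StandardModule A))) (hN : IsClosed (N : Set (StandardModule A)))
    (h : IsCompl M N) : ∃ C > 0, ∀ x ∈ M, ∀ y ∈ N, ‖x‖ ≤ C * ‖x + y‖ := by
  set V := M.restrictScalars ℂ
  set W := N.restrictScalars ℂ
  have : CompleteSpace V := IsClosed.completeSpace_coe (hs := hM)
  have : CompleteSpace W := IsClosed.completeSpace_coe (hs := hN)
  let T : (V × W) →L[ℂ] StandardModule A := V.subtypeL.coprod W.subtypeL
  have hT : ∀ p, T p = p.1 + p.2 := fun _ => rfl
  have hsurj : Function.Surjective T := fun z => by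
    obtain ⟨x, hx, y, hy, rfl⟩ := Submodule.mem_sup.1 (h.sup_eq_top ▸ Submodule.mem_top (x := z))
    exact ⟨(⟨x, hx⟩, ⟨y, hy⟩), rfl⟩
  -- Open mapping for `M × N → H_A`; disjointness identifies the preimage it supplies with the given
  -- components.
  obtain ⟨C, hC, hb⟩ := T.exists_preimage_norm_le hsurj
  refine ⟨C, hC, fun x hx y hy => ?_⟩
  obtain ⟨p, hp, hpn⟩ := hb (x + y)
  have hdiff : x - p.1 = p.2 - y := by
    rw [hT] at hp
    rw [sub_eq_sub_iff_add_eq_add, ← hp]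
    abel
  have h0 : x - p.1 = 0 := (Submodule.disjoint_def.1 h.disjoint) _ (M.sub_mem hx p.1.2)
    (hdiff ▸ N.sub_mem p.2.2 hy)
  exact (congrArg norm (sub_eq_zero.1 h0)).le.trans ((norm_fst_le p).trans hpn)

theorem exists_adjoint (F : AdjointableOperators A) :
    ∃ G : AdjointableOperators A, ∀ x y, ⟪F.1 x, y⟫_A = ⟪x, G.1 y⟫_A := by
  obtain ⟨G, hG⟩ := F.2
  exact ⟨⟨G, F.1, fun x y => by rw [← star_inner', ← hG, star_inner']⟩, hG⟩

/-- A semi-Fredholm operator is bounded below on the orthogonal complement of `N₁`. -/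
theorem IsUpperSemiFredholm.exists_projection_bounded_below {F : AdjointableOperators A}
    (hF : IsUpperSemiFredholm F) : ∃ P : AdjointableOperators A, P ∈ CompactOperators A ∧
      (∀ x, P.1 (P.1 x) = P.1 x) ∧ (∀ x y, ⟪P.1 x, y⟫_A = ⟪x, P.1 y⟫_A) ∧
      ∃ C > 0, ∀ x, ‖x - P.1 x‖ ≤ C * ‖F.1 (x - P.1 x)‖ := by
  obtain ⟨M₁, N₁, M₂, N₂, -, hN₁, hM₂, hN₂, h₁, h₂, hfg, ⟨F₁, hF₁⟩, hFN⟩ := hF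
  obtain ⟨P, hPc, hPN, hP, hPs⟩ := exists_compact_projection hfg hN₁
  obtain ⟨C, hC, hCb⟩ := exists_norm_le_mul_norm_add hM₂ hN₂ h₂
  have hQ : ∀ x, ‖x - P.1 x‖ ≤ ‖(1 - P : AdjointableOperators A)‖ * ‖x‖ := fun x =>
    (1 - P : AdjointableOperators A).1.le_opNorm x
  let G : M₂.restrictScalars ℂ →L[ℂ] M₁.restrictScalars ℂ :=
    { toFun := fun x => F₁.symm x
      map_add' := fun x y => map_add F₁.symm x y
      map_smul' := fun c x => by
        have h := map_smul F₁.symm (algebraMap ℂ A c) x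
        rw [algebraMap_smul, algebraMap_smul] at h
        exact h
      cont := F₁.symm.continuous }
  have hG : ∀ x : M₁, ‖(x : StandardModule A)‖ ≤ ‖G‖ * ‖F.1 x‖ := fun x => by
    have h := G.le_opNorm (F₁ x)
    have h' : G (F₁ x) = x := F₁.symm_apply_apply x
    rw [h'] at h
    rw [← hF₁]
    exact h
  refine ⟨P, hPc, fun x => hP _ (hPN x), hPs,
    ‖(1 - P : AdjointableOperators A)‖ * (‖G‖ * C) + 1, by positivity, fun x => ?_⟩
  obtain ⟨m, hm, y, hy, hmy⟩ :=
    Submodule.mem_sup.1 (h₁.sup_eq_top ▸ Submodule.mem_top (x := x - P.1 x))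
  -- Applying `1 - P` to `x - P x = m + y` kills `y ∈ N₁`, so the `M₁`-component alone controls the
  -- vector.
  have hxm : x - P.1 x = m - P.1 m := by
    have h0 : (x - P.1 x) - P.1 (x - P.1 x) = x - P.1 x := by
      rw [map_sub, hP _ (hPN x), sub_self, sub_zero]
    rw [← h0, ← hmy, map_add, hP y hy]
    abel
  -- `F m` is the `M₂`-component of `F (m + y)`, since `F y ∈ N₂`.
  have hFm : ‖F.1 m‖ ≤ C * ‖F.1 (x - P.1 x)‖ := by
    rw [← hmy, map_add]
    exact hCb _ (hF₁ ⟨m, hm⟩ ▸ (F₁ ⟨m, hm⟩).2) _ (hFN y hy)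
  calc ‖x - P.1 x‖ = ‖m - P.1 m‖ := by rw [hxm]
    _ ≤ ‖(1 - P : AdjointableOperators A)‖ * ‖m‖ := hQ m
    _ ≤ ‖(1 - P : AdjointableOperators A)‖ * (‖G‖ * (C * ‖F.1 (x - P.1 x)‖)) := by
      gcongr
      exact (hG ⟨m, hm⟩).trans (by gcongr)
    _ ≤ (‖(1 - P : AdjointableOperators A)‖ * (‖G‖ * C) + 1) * ‖F.1 (x - P.1 x)‖ := by
      have := norm_nonneg (F.1 (x - P.1 x))
      linarith

/-- `F* F` is bounded below only on the range of `Q = 1 - P`. Compressing it there and adding `P` on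
the complement gives an invertible `S` with `S Q = Q F* F Q`, so `S⁻¹ Q F*` inverts `F` on the range
of `Q`. -/
theorem IsUpperSemiFredholm.exists_left_inverse_mod_compact {F : AdjointableOperators A}
    (hF : IsUpperSemiFredholm F) :
    ∃ D : AdjointableOperators A, ∃ K ∈ CompactOperators A, D * F = 1 + K := by
  obtain ⟨P, hPc, hPP, hPs, C, hC, hb⟩ := hF.exists_projection_bounded_below
  obtain ⟨G, hG⟩ := exists_adjoint F
  have hG' : ∀ x y, ⟪G.1 x, y⟫_A = ⟪x, F.1 y⟫_A := fun x y => by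
    rw [← star_inner', ← hG, star_inner']
  set Q : AdjointableOperators A := 1 - P with hQ
  have hQx : ∀ x, Q.1 x = x - P.1 x := fun x => rfl
  have hQs : ∀ x y, ⟪Q.1 x, y⟫_A = ⟪x, Q.1 y⟫_A := fun x y => by
    rw [← star_inner' (Q.1 y) x, hQx, hQx, inner_sub_left', inner_sub_left', star_sub, hPs x,
      star_inner', star_inner']
  have hPQ : ∀ x, P.1 (Q.1 x) = 0 := fun x => by rw [hQx, map_sub, hPP, sub_self]
  have hQQ : ∀ x, Q.1 (Q.1 x) = Q.1 x := fun x => by rw [hQx (Q.1 x), hPQ, sub_zero]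
  set S : AdjointableOperators A := Q * G * F * Q + P with hS
  have hSx : ∀ x, S.1 x = Q.1 (G.1 (F.1 (Q.1 x))) + P.1 x := fun x => rfl
  have hSinner : ∀ x y, ⟪S.1 x, y⟫_A = ⟪F.1 (Q.1 x), F.1 (Q.1 y)⟫_A + ⟪P.1 x, P.1 y⟫_A :=
    fun x y => by rw [hSx, inner_add_left', hQs, hG', ← hPs, hPP]
  have hSs : ∀ x y, ⟪S.1 x, y⟫_A = ⟪x, S.1 y⟫_A := fun x y => by
    rw [← star_inner' (S.1 y) x, hSinner, hSinner, star_add, star_inner', star_inner']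
  -- `⟪S x, x⟫` is the sum of the squares of `F Q x` and `P x`, so each has norm at most `√‖B‖`, and
  -- `‖x‖ ≤ ‖Q x‖ + ‖P x‖ ≤ (C + 1) √‖B‖`.
  have hbound : ∀ t : ℝ, 0 ≤ t → ∀ x, ((C + 1) ^ 2)⁻¹ * ‖x‖ ≤ ‖S.1 x + (t : ℂ) • x‖ := by
    intro t ht x
    refine mul_norm_le_of_mul_norm_sq_le_inner ?_
    rw [inv_mul_le_iff₀ (by positivity)]
    set B := ⟪S.1 x + (t : ℂ) • x, x⟫_A with hB
    have hB' : B = ∑ i : Fin 2, ⟪![F.1 (Q.1 x), P.1 x] i, ![F.1 (Q.1 x), P.1 x] i⟫_A +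
        (t : ℂ) • ⟪x, x⟫_A := by
      rw [hB, inner_add_left', inner_smul_left_complex', hSinner]
      simp
    have hi : ∀ i, ‖![F.1 (Q.1 x), P.1 x] i‖ ≤ √‖B‖ := fun i => by
      refine Real.le_sqrt_of_sq_le ?_
      rw [hB']
      exact norm_le_norm_sum_inner_self_add Finset.univ _ (Finset.mem_univ i) _ ht
    have h0 : ‖F.1 (Q.1 x)‖ ≤ √‖B‖ := hi 0
    have h1 : ‖P.1 x‖ ≤ √‖B‖ := hi 1
    have hx : ‖x‖ ≤ (C + 1) * √‖B‖ := by
      calc ‖x‖ = ‖Q.1 x + P.1 x‖ := by rw [hQx, sub_add_cancel]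
        _ ≤ ‖Q.1 x‖ + ‖P.1 x‖ := norm_add_le _ _
        _ ≤ C * √‖B‖ + √‖B‖ := add_le_add ((hb x).trans (by gcongr; exact h0)) h1
        _ = (C + 1) * √‖B‖ := by ring
    calc ‖x‖ ^ 2 ≤ ((C + 1) * √‖B‖) ^ 2 := by gcongr
      _ = (C + 1) ^ 2 * ‖B‖ := by rw [mul_pow, Real.sq_sqrt (norm_nonneg _)]
  obtain ⟨u, hu⟩ := isUnit_of_forall_add_smul_bounded_below S.1 (by positivity) hbound
  set R₀ : StandardModule A →L[ℂ] StandardModule A := ↑u⁻¹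
  have hRS : ∀ x, R₀ (S.1 x) = x := fun x => by
    rw [← hu]
    exact congrArg (fun T => T x) u.inv_mul
  have hSR : ∀ x, S.1 (R₀ x) = x := fun x => by
    rw [← hu]
    exact congrArg (fun T => T x) u.mul_inv
  -- The inverse of a self-adjoint operator is its own adjoint.
  let R : AdjointableOperators A := ⟨R₀, R₀, fun x y => by
    conv_lhs => rw [← hSR y]
    rw [← hSs, hSR]⟩
  refine ⟨R * Q * G, (R * Q * G * F - 1) * P, Ideal.mul_mem_left _ _ hPc, ?_⟩
  have hDFQ : R * Q * G * F * Q = Q := Subtype.ext <| ContinuousLinearMap.ext fun x => by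
    change R₀ (Q.1 (G.1 (F.1 (Q.1 x)))) = Q.1 x
    have h := hRS (Q.1 x)
    rwa [hSx, hQQ, hPQ, add_zero] at h
  have h1 : (1 : AdjointableOperators A) = Q + P := by rw [hQ, sub_add_cancel]
  calc R * Q * G * F = R * Q * G * F * Q + R * Q * G * F * P := by rw [← mul_add, ← h1, mul_one]
    _ = 1 + (R * Q * G * F - 1) * P := by
      rw [hDFQ, sub_mul, one_mul, hQ]
      abel

end Necessity

theorem theorem2p2 {A : Type*} [CStarAlgebra A] (F : AdjointableOperators A) :
    (IsUpperSemiFredholm F ↔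
      ∃ D : AdjointableOperators A, ∃ K ∈ CompactOperators A, D * F = 1 + K) ∧
    (IsUpperSemiFredholm F ↔
      ∃ d : CalkinAlgebra A, d * Ideal.Quotient.mk (CompactOperators A) F = 1) := by
  have h : IsUpperSemiFredholm F ↔
      ∃ D : AdjointableOperators A, ∃ K ∈ CompactOperators A, D * F = 1 + K :=
    ⟨fun hF => hF.exists_left_inverse_mod_compact,
      fun ⟨_, _, hK, hDF⟩ => isUpperSemiFredholm_of_left_inverse_mod_compact hK hDF⟩
  refine ⟨h, h.trans ⟨?_, ?_⟩⟩
  · rintro ⟨D, K, hK, hDF⟩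
    refine ⟨Ideal.Quotient.mk _ D, ?_⟩
    rw [← RingHom.map_mul, ← RingHom.map_one (Ideal.Quotient.mk (CompactOperators A)),
      Ideal.Quotient.eq, hDF, add_sub_cancel_left]
    exact hK
  · rintro ⟨d, hd⟩
    obtain ⟨D, rfl⟩ := Ideal.Quotient.mk_surjective d
    refine ⟨D, D * F - 1, ?_, by abel⟩
    rwa [← RingHom.map_mul, ← RingHom.map_one (Ideal.Quotient.mk (CompactOperators A)),
      Ideal.Quotient.eq] at hd
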